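/- Let $\mathcal X=\mathcal Y\subset\mathbb R^D$ be a nonempty compact set, let $\mathbb P,\mathbb Q$ be Borel probability measures on $\mathcal X$, and let $\mathbb S$ be an atomless Borel probability measure on a Polish space $\mathcal Z$. Let $k:\mathcal Y\times\mathcal Y\to\mathbb R$ be a continuous positive definite symmetric kernel, i.e. $k(y,y')=\langle u(y),u(y')\rangle_{\mathcal H}$ for a feature map $u:\mathcal Y\to\mathcal H$ into a real Hilbert space, and suppose that $k$ is characteristic: the mean embedding $\mu\mapsto\int_{\mathcal Y}u(y)\,d\mu(y)$ is one-to-one on the set $\mathcal P(\mathcal Y)$ of Borel probability measures on $\mathcal Y$. For $\gamma\in(0,1]$, $x\in\mathcal X$ and $\mu\in\mathcal P(\mathcal Y)$ put $$C_{k,\gamma}(x,\mu)=\tfrac12k(x,x)+\tfrac{1-\gamma}{2}\int_{\mathcal Y} k(y,y)\,d\mu(y)-\int_{\mathcal Y} k(x,y)\,d\mu(y)+\tfrac{\gamma}{2}\int_{\mathcal Y\times\mathcal Y}k(y,y')\,d\mu(y)\,d\mu(y').$$ A probability measure $\pi$ on $\mathcal X\times\mathcal Y$ with marginals $\mathbb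 P$ and $\mathbb Q$ is called an optimal transport (OT) plan if it minimizes $\int_{\mathcal X}C_{k,\gamma}(x,\pi(\cdot|x))\,d\mathbb P(x)$ among all such measures, where $\pi(\cdot|x)$ is the conditional distribution of $y$ given $x$. For continuous $f:\mathcal Y\to\mathbb R$ and measurable $T:\mathcal X\times\mathcal Z\to\mathcal Y$, with $T_x=T(x,\cdot)$, let $$\mathcal L(f,T)=\int_{\mathcal X}\Big(C_{k,\gamma}(x,T_x\sharp\mathbb S)-\int_{\mathcal Z}f(T_x(z))\,d\mathbb S(z)\Big)d\mathbb P(x)+\int_{\mathcal Y}f(y)\,d\mathbb Q(y).$$ Then there is exactly one OT plan $\pi^*$, and for every optimal potential, i.e. every continuous $f^*$ attaining $\sup_f\inf_T\mathcal L(f,T)$ (supremum over continuous $f$, infimum over measurable $T$), and every measurable $T^*:\mathcal X\times\mathcal Z\to\mathcal Y$, $$T^*\in\operatorname*{arg\,inf}_T\mathcal L(f^*,T)\iff T^*_x\sharp\mathbb S=\pi^*(\cdot|x)\ \text{ for }\mathbb P\text{-almost every }x\in\mathcal X.$$ In particular, every optimal saddle point $(f^*,T^*)$ provides a stochastic OT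 map $T^*$, i.e. a measurable map with $T^*_x\sharp\mathbb S=\pi^*(\cdot|x)$ for $\mathbb P$-almost every $x$. -/

import Mathlib

open MeasureTheory ProbabilityTheory

namespace KernelNOT

noncomputable section

section Kernels

variable {Y : Type*}

/-- `u : Y → H` is a feature map of the positive definite symmetric (PDS) kernel `k`. -/
def IsFeatureMap {H : Type*} [NormedAddCommGroup H] [InnerProductSpace ℝ H]
    (k : Y → Y → ℝ) (u : Y → H) : Prop :=
  ∀ y y' : Y, k y y' = inner ℝ (u y) (u y')

/-- The kernel mean embedding `μ ↦ u(μ) = ∫ u(y) dμ(y)` on the probability measures on `Y`. -/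
def meanEmbedding {H : Type*} [NormedAddCommGroup H] [InnerProductSpace ℝ H]
    [MeasurableSpace Y] (u : Y → H) (μ : ProbabilityMeasure Y) : H :=
  ∫ y, u y ∂(μ : Measure Y)

/-- The kernel with feature map `u` is characteristic: its mean embedding is one-to-one. -/
def IsCharacteristic {H : Type*} [NormedAddCommGroup H] [InnerProductSpace ℝ H]
    [MeasurableSpace Y] (u : Y → H) : Prop :=
  Function.Injective (meanEmbedding (Y := Y) u)

/-- The `γ`-weak kernel cost `C_{k,γ}(x, μ)`. It is only ever used for probability measures `μ`. -/
def weakKernelCost [MeasurableSpace Y] (k : Y → Y → ℝ) (γ : ℝ) (x : Y) (μ : Measure Y) : ℝ :=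
  (1 / 2) * k x x + ((1 - γ) / 2) * (∫ y, k y y ∂μ) - (∫ y, k x y ∂μ)
    + (γ / 2) * ∫ p : Y × Y, k p.1 p.2 ∂(μ.prod μ)

end Kernels

section WeakOT

variable {X Y Z : Type*} [MeasurableSpace X] [MeasurableSpace Y] [MeasurableSpace Z]

/-- `π ∈ Π(P, Q)`: `π` is a probability measure on `X × Y` with marginals `P` and `Q`. -/
def IsTransportPlan (P : Measure X) (Q : Measure Y) (π : ProbabilityMeasure (X × Y)) : Prop :=
  (π : Measure (X × Y)).fst = P ∧ (π : Measure (X × Y)).snd = Q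

/-- The conditional distribution `π(· | x)` (a regular version of it). -/
def condDist [StandardBorelSpace Y] [Nonempty Y] (π : ProbabilityMeasure (X × Y)) (x : X) :
    Measure Y :=
  (π : Measure (X × Y)).condKernel x

/-- The weak transport cost `∫ C(x, π(· | x)) dπ(x)` of the plan `π`. -/
def planCost [StandardBorelSpace Y] [Nonempty Y] (C : X → Measure Y → ℝ)
    (π : ProbabilityMeasure (X × Y)) : ℝ :=
  ∫ x, C x (condDist π x) ∂(π : Measure (X × Y)).fst

/-- `π` is an optimal transport plan between `P` and `Q` for the weak cost `C`. -/
def IsOTPlan [StandardBorelSpace Y] [Nonempty Y] (C : X → Measure Y → ℝ)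
    (P : Measure X) (Q : Measure Y) (π : ProbabilityMeasure (X × Y)) : Prop :=
  IsTransportPlan P Q π ∧ ∀ π', IsTransportPlan P Q π' → planCost C π ≤ planCost C π'

/-- The distribution `T_x ♯ S` on `Y`. -/
def pushAt (S : Measure Z) (T : X × Z → Y) (x : X) : Measure Y :=
  S.map fun z => T (x, z)

/-- `T` represents the plan `π`, i.e. `T_x ♯ S = π(· | x)` for `P`-almost every `x`. -/
def Represents [StandardBorelSpace Y] [Nonempty Y] (P : Measure X) (S : Measure Z)
    (T : X × Z → Y) (π : ProbabilityMeasure (X × Y)) : Prop :=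
  ∀ᵐ x ∂P, pushAt S T x = condDist π x

/-- `T` is a stochastic OT map between `P` and `Q`: it represents some OT plan. -/
def IsStochasticOTMap [StandardBorelSpace Y] [Nonempty Y] (C : X → Measure Y → ℝ)
    (P : Measure X) (Q : Measure Y) (S : Measure Z) (T : X × Z → Y) : Prop :=
  Measurable T ∧ ∃ π, IsOTPlan C P Q π ∧ Represents P S T π

variable [TopologicalSpace Y]

/-- The functional `L(f, T)` of the saddle point problem. -/
def saddle (C : X → Measure Y → ℝ) (P : Measure X) (Q : Measure Y) (S : Measure Z)
    (f : C(Y, ℝ)) (T : X × Z → Y) : ℝ :=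
  (∫ x, (C x (pushAt S T x) - ∫ z, f (T (x, z)) ∂S) ∂P) + ∫ y, f y ∂Q

/-- `inf_T L(f, T)`, the infimum being over the measurable `T : X × Z → Y`. -/
def dualValue (C : X → Measure Y → ℝ) (P : Measure X) (Q : Measure Y) (S : Measure Z)
    (f : C(Y, ℝ)) : ℝ :=
  ⨅ T : {T : X × Z → Y // Measurable T}, saddle C P Q S f T.1

/-- `f ∈ argsup_f inf_T L(f, T)`. On a compact `Y` the admissible potentials are exactly the
continuous functions. -/
def IsOptimalPotential (C : X → Measure Y → ℝ) (P : Measure X) (Q : Measure Y) (S : Measure Z)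
    (f : C(Y, ℝ)) : Prop :=
  ∀ g : C(Y, ℝ), dualValue C P Q S g ≤ dualValue C P Q S f

/-- `T ∈ arginf_T L(f, T)`, the infimum being over the measurable `T : X × Z → Y`. -/
def IsArginf (C : X → Measure Y → ℝ) (P : Measure X) (Q : Measure Y) (S : Measure Z)
    (f : C(Y, ℝ)) (T : X × Z → Y) : Prop :=
  Measurable T ∧ ∀ T' : X × Z → Y, Measurable T' → saddle C P Q S f T ≤ saddle C P Q S f T'

end WeakOT

end

end KernelNOT

/-!
The proof is a first-order argument on the compact set of plans with first marginal `P`.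

Write `h_π(x) = ∫ u(y) dπ(y | x)` for the conditional mean embedding of a plan `π`. The transport
cost of `π` is the integral of a continuous function against `π` plus `γ/2` times the squared norm
of `h_π` in `L²(P)` (`planCost_eq`). Completing the square (`integral_two_inner_sub_norm_sq`)
exhibits that squared norm as a supremum of functionals affine in `π`, which gives two things at
once: the cost is weakly lower semicontinuous on the whole space of plans, although `π ↦ π(· | x)`
is not continuous (`lowerSemicontinuous_planCost`), and it satisfies a parallelogram identity
(`planCost_midPlan`). As the kernel is characteristic, the latter makes every functional "cost plus
continuous linear term" strictly convex along plans with a common first marginal, so that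
minimizers exist by compactness and are unique (`eq_of_le_midPlan`).

Since `S` is atomless, every plan with first marginal `P` is induced by a measurable `T`
(`exists_mapPlan_eq`), and `L(f, T)` depends only on the induced plan: it is the Lagrangian
`cost(π) - ∫ f(y) dπ + ∫ f dQ`. Hence `inf_T L(f, T)` is the minimum of the Lagrangian over the
plans with first marginal `P`, attained at exactly one plan `π_f`, and the minimizing `T` are those
representing `π_f` (`isArginf_iff_represents`).

No minimax theorem is needed to identify `π_f` for an optimal potential `f`. The directional
derivative at `f` of the concave function `f ↦ inf_T L(f, T)` in the direction `g` is
`∫ g dQ - ∫ g(y) dπ_f`; at a maximum it vanishes for every `g`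
(`integral_le_integral_of_isMax`), so `π_f` has second marginal `Q`. On plans with second marginal
`Q` the Lagrangian is the transport cost, so `π_f` is the optimal plan.
-/

namespace KernelNOT

open scoped Topology ENNReal unitInterval

/-! ### Feature maps and the conditional mean embedding -/

lemma IsFeatureMap.continuous {Y H : Type*} [TopologicalSpace Y] [NormedAddCommGroup H]
    [InnerProductSpace ℝ H] {k : Y → Y → ℝ} {u : Y → H} (hu : IsFeatureMap k u)
    (hk : Continuous fun p : Y × Y => k p.1 p.2) : Continuous u := by
  rw [continuous_iff_continuousAt]
  intro x
  have hsq : ∀ y, ‖u y - u x‖ ^ 2 = k y y - 2 * k y x + k x x := by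
    intro y
    rw [norm_sub_sq_real, hu y y, hu y x, hu x x, real_inner_self_eq_norm_sq,
      real_inner_self_eq_norm_sq]
  have hlim : Filter.Tendsto (fun y => ‖u y - u x‖ ^ 2) (𝓝 x) (𝓝 0) := by
    have hc : Continuous fun y => k y y - 2 * k y x + k x x :=
      ((hk.comp (continuous_id.prodMk continuous_id)).sub (continuous_const.mul
        (hk.comp (continuous_id.prodMk continuous_const)))).add continuous_const
    have h := hc.tendsto x
    simp only [← hsq, sub_self, norm_zero, ne_eq, OfNat.ofNat_ne_zero, not_false_eq_true,
      zero_pow] at h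
    exact h
  rw [ContinuousAt, tendsto_iff_norm_sub_tendsto_zero]
  simpa using hlim.sqrt

lemma integrable_of_continuous {X E : Type*} [TopologicalSpace X] [CompactSpace X]
    [MeasurableSpace X] [OpensMeasurableSpace X] [TopologicalSpace.PseudoMetrizableSpace X]
    [SecondCountableTopology X] [NormedAddCommGroup E] {f : X → E} (hf : Continuous f)
    (μ : Measure X) [IsFiniteMeasure μ] : Integrable f μ := by
  obtain ⟨C, hC⟩ := isCompact_univ.exists_bound_of_continuousOn hf.continuousOn
  exact Integrable.of_bound hf.aestronglyMeasurable C (.of_forall fun x => hC x trivial)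

lemma exists_norm_le_of_continuous {X E : Type*} [TopologicalSpace X] [CompactSpace X]
    [NormedAddCommGroup E] {f : X → E} (hf : Continuous f) : ∃ C, ∀ x, ‖f x‖ ≤ C := by
  obtain ⟨C, hC⟩ := isCompact_univ.exists_bound_of_continuousOn hf.continuousOn
  exact ⟨C, fun x => hC x trivial⟩

lemma integrable_norm_sq_of_bound {X E : Type*} [MeasurableSpace X]
    [NormedAddCommGroup E] {μ : Measure X} [IsFiniteMeasure μ] {g : X → E}
    (hg : StronglyMeasurable g) {B : ℝ} (hB : ∀ x, ‖g x‖ ≤ B) :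
    Integrable (fun x => ‖g x‖ ^ 2) μ := by
  refine Integrable.of_bound (hg.norm.pow 2).aestronglyMeasurable (B ^ 2) (.of_forall fun x => ?_)
  rw [norm_pow, norm_norm]
  exact pow_le_pow_left₀ (norm_nonneg _) (hB x) 2

section CondEmbedding

variable {X Y : Type*} [MeasurableSpace X] [MeasurableSpace Y] [StandardBorelSpace Y] [Nonempty Y]

instance (π : ProbabilityMeasure (X × Y)) (x : X) : IsProbabilityMeasure (condDist π x) := by
  unfold condDist; infer_instance

lemma integral_condDist {E : Type*} [NormedAddCommGroup E] [NormedSpace ℝ E]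
    (π : ProbabilityMeasure (X × Y)) {F : X × Y → E} (hF : Integrable F (π : Measure (X × Y))) :
    ∫ x, ∫ y, F (x, y) ∂(condDist π x) ∂(π : Measure (X × Y)).fst
      = ∫ p, F p ∂(π : Measure (X × Y)) :=
  Measure.integral_condKernel hF

variable {H : Type*} [NormedAddCommGroup H] [InnerProductSpace ℝ H]

/-- The kernel mean embedding `∫ u(y) dπ(y | x)` of the conditional distribution of `π` at `x`. -/
noncomputable def condEmbedding (u : Y → H) (π : ProbabilityMeasure (X × Y)) (x : X) : H :=
  ∫ y, u y ∂(condDist π x)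

lemma stronglyMeasurable_condEmbedding {u : Y → H} (hu : StronglyMeasurable u)
    (π : ProbabilityMeasure (X × Y)) : StronglyMeasurable (condEmbedding u π) :=
  hu.integral_kernel (κ := (π : Measure (X × Y)).condKernel)

lemma norm_condEmbedding_le {u : Y → H} {C : ℝ} (hC : ∀ y, ‖u y‖ ≤ C)
    (π : ProbabilityMeasure (X × Y)) (x : X) : ‖condEmbedding u π x‖ ≤ C := by
  have h := norm_integral_le_of_norm_le_const (μ := condDist π x) (.of_forall hC)
  simpa [condEmbedding] using h

/-- Completing the square fibrewise: testing `π` against `2⟨g(x), u(y)⟩ - ‖g(x)‖²` falls short of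
the squared `L²` norm of the conditional embedding by the squared `L²` distance from `g` to it.
The left-hand side is affine in `π`, so this controls the quadratic part of the transport cost. -/
lemma integral_two_inner_sub_norm_sq [CompleteSpace H] {u : Y → H} (hu : StronglyMeasurable u)
    {C : ℝ} (hC : ∀ y, ‖u y‖ ≤ C) (π : ProbabilityMeasure (X × Y)) {g : X → H}
    (hg : StronglyMeasurable g) {B : ℝ} (hB : ∀ x, ‖g x‖ ≤ B) :
    Integrable (fun p : X × Y => 2 * inner ℝ (g p.1) (u p.2) - ‖g p.1‖ ^ 2)
        (π : Measure (X × Y)) ∧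
      ∫ p, (2 * inner ℝ (g p.1) (u p.2) - ‖g p.1‖ ^ 2) ∂(π : Measure (X × Y))
        = (∫ x, ‖condEmbedding u π x‖ ^ 2 ∂(π : Measure (X × Y)).fst)
          - ∫ x, ‖g x - condEmbedding u π x‖ ^ 2 ∂(π : Measure (X × Y)).fst := by
  have hgu : StronglyMeasurable fun p : X × Y => inner ℝ (g p.1) (u p.2) :=
    (hg.comp_measurable measurable_fst).inner (hu.comp_measurable measurable_snd)
  have hint : Integrable (fun p : X × Y => 2 * inner ℝ (g p.1) (u p.2) - ‖g p.1‖ ^ 2)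
      (π : Measure (X × Y)) := by
    refine Integrable.sub (Integrable.const_mul ?_ 2)
      (integrable_norm_sq_of_bound (hg.comp_measurable measurable_fst) fun p => hB p.1)
    refine Integrable.of_bound hgu.aestronglyMeasurable (B * C) (.of_forall fun p => ?_)
    exact (norm_inner_le_norm _ _).trans
      (mul_le_mul (hB _) (hC _) (norm_nonneg _) ((norm_nonneg _).trans (hB p.1)))
  refine ⟨hint, ?_⟩
  have hh := stronglyMeasurable_condEmbedding hu π
  have hhC := norm_condEmbedding_le hC π
  have hsub : Integrable (fun x => ‖g x - condEmbedding u π x‖ ^ 2)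
      (π : Measure (X × Y)).fst :=
    integrable_norm_sq_of_bound (hg.sub hh) (B := B + C) fun x =>
      (norm_sub_le _ _).trans (add_le_add (hB x) (hhC x))
  rw [← integral_condDist π hint, ← integral_sub (integrable_norm_sq_of_bound hh hhC) hsub]
  refine integral_congr_ae (.of_forall fun x => ?_)
  have hui : Integrable u (condDist π x) :=
    Integrable.of_bound hu.aestronglyMeasurable C (.of_forall hC)
  have h1 : ∫ y, (2 * inner ℝ (g x) (u y) - ‖g x‖ ^ 2) ∂(condDist π x)
      = 2 * inner ℝ (g x) (condEmbedding u π x) - ‖g x‖ ^ 2 := by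
    rw [integral_sub ((hui.const_inner (g x)).const_mul 2) (integrable_const _),
      integral_const_mul, integral_inner hui]
    simp [condEmbedding]
  simp only [h1, norm_sub_sq_real]
  ring

end CondEmbedding

/-! ### The transport cost as a function of the plan -/

/-- The pointwise cost `k(x,x)/2 + (1-γ) k(y,y)/2 - k(x,y)`: the part of the `γ`-weak kernel cost
that is affine in the measure. -/
noncomputable def pointCost {Y : Type*} (k : Y → Y → ℝ) (γ : ℝ) (p : Y × Y) : ℝ :=
  (1 / 2) * k p.1 p.1 + ((1 - γ) / 2) * k p.2 p.2 - k p.1 p.2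

lemma continuous_pointCost {Y : Type*} [TopologicalSpace Y] {k : Y → Y → ℝ}
    (hk : Continuous fun p : Y × Y => k p.1 p.2) (γ : ℝ) : Continuous (pointCost k γ) := by
  have h1 : Continuous fun p : Y × Y => k p.1 p.1 := hk.comp (continuous_fst.prodMk continuous_fst)
  have h2 : Continuous fun p : Y × Y => k p.2 p.2 := hk.comp (continuous_snd.prodMk continuous_snd)
  exact ((continuous_const.mul h1).add (continuous_const.mul h2)).sub hk

section PlanCost

variable {Y : Type*} [MetricSpace Y] [CompactSpace Y] [MeasurableSpace Y] [BorelSpace Y]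
  {H : Type*} [NormedAddCommGroup H] [InnerProductSpace ℝ H] {k : Y → Y → ℝ} {u : Y → H}

lemma weakKernelCost_eq [CompleteSpace H] (hu : IsFeatureMap k u)
    (hk : Continuous fun p : Y × Y => k p.1 p.2) (γ : ℝ) (x : Y) (μ : Measure Y)
    [IsProbabilityMeasure μ] :
    weakKernelCost k γ x μ
      = (∫ y, pointCost k γ (x, y) ∂μ) + (γ / 2) * ‖∫ y, u y ∂μ‖ ^ 2 := by
  have hui : Integrable u μ := integrable_of_continuous (hu.continuous hk) μ
  have h1 : Integrable (fun y => k y y) μ :=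
    integrable_of_continuous (hk.comp (continuous_id.prodMk continuous_id)) μ
  have h2 : Integrable (fun y => k x y) μ :=
    integrable_of_continuous (hk.comp (continuous_const.prodMk continuous_id)) μ
  have h3 : ∫ p : Y × Y, k p.1 p.2 ∂(μ.prod μ) = ‖∫ y, u y ∂μ‖ ^ 2 := by
    rw [integral_prod _ (integrable_of_continuous hk _), ← real_inner_self_eq_norm_sq,
      ← integral_inner hui]
    refine integral_congr_ae (.of_forall fun y => ?_)
    simp only [hu y]
    rw [integral_inner hui, real_inner_comm]
  have h4 : ∫ y, pointCost k γ (x, y) ∂μ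
      = (1 / 2) * k x x + ((1 - γ) / 2) * (∫ y, k y y ∂μ) - ∫ y, k x y ∂μ := by
    simp only [pointCost]
    have h5 : Integrable (fun y => (1 / 2) * k x x + ((1 - γ) / 2) * k y y) μ :=
      (integrable_const _).add (h1.const_mul _)
    rw [integral_sub h5 h2, integral_add (integrable_const _) (h1.const_mul _),
      integral_const_mul ((1 - γ) / 2)]
    simp
  rw [weakKernelCost, h3, h4]

lemma integrable_weakKernelCost_condDist [Nonempty Y] [CompleteSpace H] (hu : IsFeatureMap k u)
    (hk : Continuous fun p : Y × Y => k p.1 p.2) (γ : ℝ) (π : ProbabilityMeasure (Y × Y)) :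
    Integrable (fun x => weakKernelCost k γ x (condDist π x)) (π : Measure (Y × Y)).fst := by
  have huc := hu.continuous hk
  obtain ⟨C, hC⟩ := exists_norm_le_of_continuous huc
  simp only [weakKernelCost_eq hu hk γ]
  exact (integrable_of_continuous (continuous_pointCost hk γ)
    (π : Measure (Y × Y))).integral_condKernel.add ((integrable_norm_sq_of_bound
      (stronglyMeasurable_condEmbedding huc.stronglyMeasurable π)
      (norm_condEmbedding_le hC π)).const_mul _)

lemma planCost_eq [Nonempty Y] [CompleteSpace H] (hu : IsFeatureMap k u)
    (hk : Continuous fun p : Y × Y => k p.1 p.2) (γ : ℝ) (π : ProbabilityMeasure (Y × Y)) :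
    planCost (weakKernelCost k γ) π
      = (∫ p, pointCost k γ p ∂(π : Measure (Y × Y)))
        + (γ / 2) * ∫ x, ‖condEmbedding u π x‖ ^ 2 ∂(π : Measure (Y × Y)).fst := by
  have huc := hu.continuous hk
  obtain ⟨C, hC⟩ := exists_norm_le_of_continuous huc
  have hc := integrable_of_continuous (continuous_pointCost hk γ) (π : Measure (Y × Y))
  rw [planCost, ← integral_condDist π hc, ← integral_const_mul, ← integral_add]
  · exact integral_congr_ae (.of_forall fun x => weakKernelCost_eq hu hk γ x _)
  · exact hc.integral_condKernel
  · exact (integrable_norm_sq_of_bound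
      (stronglyMeasurable_condEmbedding huc.stronglyMeasurable π)
      (norm_condEmbedding_le hC π)).const_mul _

lemma continuous_integral_probabilityMeasure {X : Type*} [TopologicalSpace X] [CompactSpace X]
    [MeasurableSpace X] [OpensMeasurableSpace X] {F : X → ℝ} (hF : Continuous F) :
    Continuous fun π : ProbabilityMeasure X => ∫ p, F p ∂(π : Measure X) :=
  ProbabilityMeasure.continuous_integral_continuousMap (⟨F, hF⟩ : C(X, ℝ))

/-- The squared `L²` norm of the conditional embedding is weakly lower semicontinuous, being the
supremum of the weakly continuous functionals `π ↦ ∫ 2⟨g(x), u(y)⟩ - ‖g(x)‖² dπ` over the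
continuous `g`. -/
lemma lowerSemicontinuous_integral_norm_condEmbedding_sq [Nonempty Y] [CompleteSpace H]
    (hu : Continuous u) :
    LowerSemicontinuous fun π : ProbabilityMeasure (Y × Y) =>
      ∫ x, ‖condEmbedding u π x‖ ^ 2 ∂(π : Measure (Y × Y)).fst := by
  obtain ⟨C, hC⟩ := exists_norm_le_of_continuous hu
  intro π₀ a ha
  have hh := stronglyMeasurable_condEmbedding hu.stronglyMeasurable π₀
  have hmem : MemLp (condEmbedding u π₀) (ENNReal.ofReal 2) (π₀ : Measure (Y × Y)).fst :=
    MemLp.of_bound hh.aestronglyMeasurable C (.of_forall (norm_condEmbedding_le hC π₀))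
  set b := ∫ x, ‖condEmbedding u π₀ x‖ ^ 2 ∂(π₀ : Measure (Y × Y)).fst with hb
  obtain ⟨g, hg, -⟩ := hmem.exists_boundedContinuous_integral_rpow_sub_le two_pos
    (half_pos (sub_pos.2 ha))
  have hgs : StronglyMeasurable g := g.continuous.stronglyMeasurable
  have hid := fun π : ProbabilityMeasure (Y × Y) =>
    (integral_two_inner_sub_norm_sq hu.stronglyMeasurable hC π hgs g.norm_coe_le_norm).2
  have hcont : Continuous fun π : ProbabilityMeasure (Y × Y) =>
      ∫ p, (2 * inner ℝ (g p.1) (u p.2) - ‖g p.1‖ ^ 2) ∂(π : Measure (Y × Y)) := by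
    apply continuous_integral_probabilityMeasure
    have h1 : Continuous fun p : Y × Y => g p.1 := g.continuous.comp continuous_fst
    exact (continuous_const.mul (h1.inner (hu.comp continuous_snd))).sub (h1.norm.pow 2)
  have hlt : a < ∫ p, (2 * inner ℝ (g p.1) (u p.2) - ‖g p.1‖ ^ 2) ∂(π₀ : Measure (Y × Y)) := by
    rw [hid π₀]
    have : ∫ x, ‖g x - condEmbedding u π₀ x‖ ^ 2 ∂(π₀ : Measure (Y × Y)).fst ≤ (b - a) / 2 := by
      refine le_trans (le_of_eq ?_) hg
      refine integral_congr_ae (.of_forall fun x => ?_)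
      simp only [norm_sub_rev (g x), Real.rpow_two]
    linarith
  filter_upwards [hcont.continuousAt.eventually (lt_mem_nhds hlt)] with π hπ
  refine lt_of_lt_of_le hπ ?_
  rw [hid π]
  exact sub_le_self _ (integral_nonneg fun x => by positivity)

lemma lowerSemicontinuous_planCost [Nonempty Y] [CompleteSpace H] (hu : IsFeatureMap k u)
    (hk : Continuous fun p : Y × Y => k p.1 p.2) {γ : ℝ} (hγ : 0 ≤ γ) :
    LowerSemicontinuous fun π : ProbabilityMeasure (Y × Y) =>
      planCost (weakKernelCost k γ) π := by
  simp only [planCost_eq hu hk γ]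
  refine (continuous_integral_probabilityMeasure
    (continuous_pointCost hk γ)).lowerSemicontinuous.add ?_
  exact (continuous_const_mul (γ / 2)).comp_lowerSemicontinuous
    (lowerSemicontinuous_integral_norm_condEmbedding_sq (hu.continuous hk))
    (monotone_mul_left_of_nonneg (by positivity))

end PlanCost

/-! ### Strict convexity and uniqueness of minimizers -/

section Convexity

/-- The mixture `(π₁ + π₂) / 2` of two probability measures. -/
noncomputable def midPlan {X : Type*} [MeasurableSpace X] (π₁ π₂ : ProbabilityMeasure X) :
    ProbabilityMeasure X :=
  ⟨(2⁻¹ : ℝ≥0∞) • (π₁ : Measure X) + (2⁻¹ : ℝ≥0∞) • (π₂ : Measure X), ⟨by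
    simp [ENNReal.inv_two_add_inv_two]⟩⟩

lemma coe_midPlan {X : Type*} [MeasurableSpace X] (π₁ π₂ : ProbabilityMeasure X) :
    (midPlan π₁ π₂ : Measure X)
      = (2⁻¹ : ℝ≥0∞) • (π₁ : Measure X) + (2⁻¹ : ℝ≥0∞) • (π₂ : Measure X) := rfl

lemma integral_midPlan {X : Type*} [MeasurableSpace X] {π₁ π₂ : ProbabilityMeasure X} {F : X → ℝ}
    (h₁ : Integrable F (π₁ : Measure X)) (h₂ : Integrable F (π₂ : Measure X)) :
    ∫ p, F p ∂(midPlan π₁ π₂ : Measure X)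
      = ((∫ p, F p ∂(π₁ : Measure X)) + ∫ p, F p ∂(π₂ : Measure X)) / 2 := by
  rw [coe_midPlan, integral_add_measure (h₁.smul_measure (by simp)) (h₂.smul_measure (by simp)),
    integral_smul_measure, integral_smul_measure]
  simp only [ENNReal.toReal_inv, ENNReal.toReal_ofNat, smul_eq_mul]
  ring

lemma map_midPlan_of_map_eq {X Y : Type*} [MeasurableSpace X] [MeasurableSpace Y] {T : X → Y}
    (hT : Measurable T) {π₁ π₂ : ProbabilityMeasure X} {P : Measure Y}
    (h₁ : (π₁ : Measure X).map T = P) (h₂ : (π₂ : Measure X).map T = P) :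
    (midPlan π₁ π₂ : Measure X).map T = P := by
  rw [coe_midPlan, Measure.map_add _ _ hT, Measure.map_smul, Measure.map_smul, h₁, h₂, ← add_smul,
    ENNReal.inv_two_add_inv_two, one_smul]

lemma eq_of_condDist_ae_eq {X Y : Type*} [MeasurableSpace X] [MeasurableSpace Y]
    [StandardBorelSpace Y] [Nonempty Y] {π₁ π₂ : ProbabilityMeasure (X × Y)} {P : Measure X}
    (h₁ : (π₁ : Measure (X × Y)).fst = P) (h₂ : (π₂ : Measure (X × Y)).fst = P)
    (h : ∀ᵐ x ∂P, condDist π₁ x = condDist π₂ x) : π₁ = π₂ := by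
  apply Subtype.ext
  change (π₁ : Measure (X × Y)) = (π₂ : Measure (X × Y))
  rw [← (π₁ : Measure (X × Y)).disintegrate (π₁ : Measure (X × Y)).condKernel,
    ← (π₂ : Measure (X × Y)).disintegrate (π₂ : Measure (X × Y)).condKernel, h₁, h₂]
  exact Measure.compProd_congr h

variable {Y : Type*} [MetricSpace Y] [CompactSpace Y] [MeasurableSpace Y] [BorelSpace Y]
  [Nonempty Y] {H : Type*} [NormedAddCommGroup H] [InnerProductSpace ℝ H] [CompleteSpace H]
  {k : Y → Y → ℝ} {u : Y → H}

/-- The parallelogram identity for the transport cost: the defect of convexity at a midpoint is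
measured by the `L²` distances of the conditional embeddings to the one of the midpoint. -/
lemma planCost_midPlan (hu : IsFeatureMap k u) (hk : Continuous fun p : Y × Y => k p.1 p.2)
    (γ : ℝ) (π₁ π₂ : ProbabilityMeasure (Y × Y)) :
    planCost (weakKernelCost k γ) (midPlan π₁ π₂)
      = (planCost (weakKernelCost k γ) π₁ + planCost (weakKernelCost k γ) π₂) / 2
        - (γ / 4) * ((∫ x, ‖condEmbedding u (midPlan π₁ π₂) x - condEmbedding u π₁ x‖ ^ 2
              ∂(π₁ : Measure (Y × Y)).fst)
            + ∫ x, ‖condEmbedding u (midPlan π₁ π₂) x - condEmbedding u π₂ x‖ ^ 2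
              ∂(π₂ : Measure (Y × Y)).fst) := by
  have huc := (hu.continuous hk)
  obtain ⟨C, hC⟩ := exists_norm_le_of_continuous huc
  have hc := fun π : ProbabilityMeasure (Y × Y) =>
    integrable_of_continuous (continuous_pointCost hk γ) (π : Measure (Y × Y))
  have hg := stronglyMeasurable_condEmbedding huc.stronglyMeasurable (midPlan π₁ π₂)
  have hB := norm_condEmbedding_le hC (midPlan π₁ π₂)
  obtain ⟨hi, hm⟩ := integral_two_inner_sub_norm_sq huc.stronglyMeasurable hC (midPlan π₁ π₂) hg hB
  obtain ⟨hi₁, hm₁⟩ := integral_two_inner_sub_norm_sq huc.stronglyMeasurable hC π₁ hg hB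
  obtain ⟨hi₂, hm₂⟩ := integral_two_inner_sub_norm_sq huc.stronglyMeasurable hC π₂ hg hB
  rw [integral_midPlan hi₁ hi₂, hm₁, hm₂] at hm
  simp only [sub_self, norm_zero, ne_eq, OfNat.ofNat_ne_zero, not_false_eq_true, zero_pow,
    integral_zero, sub_zero] at hm
  simp only [planCost_eq hu hk γ]
  rw [integral_midPlan (hc π₁) (hc π₂), ← hm]
  ring

/-- Two plans with the same first marginal coincide if neither is beaten by their midpoint, for
the transport cost plus a continuous linear term. -/
lemma eq_of_le_midPlan (hu : IsFeatureMap k u) (hk : Continuous fun p : Y × Y => k p.1 p.2)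
    (hchar : IsCharacteristic u) {γ : ℝ} (hγ : 0 < γ) {F : Y × Y → ℝ} (hF : Continuous F)
    {π₁ π₂ : ProbabilityMeasure (Y × Y)} {P : Measure Y}
    (h₁ : (π₁ : Measure (Y × Y)).fst = P) (h₂ : (π₂ : Measure (Y × Y)).fst = P)
    (hle₁ : planCost (weakKernelCost k γ) π₁ + ∫ p, F p ∂(π₁ : Measure (Y × Y))
      ≤ planCost (weakKernelCost k γ) (midPlan π₁ π₂)
        + ∫ p, F p ∂(midPlan π₁ π₂ : Measure (Y × Y)))
    (hle₂ : planCost (weakKernelCost k γ) π₂ + ∫ p, F p ∂(π₂ : Measure (Y × Y))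
      ≤ planCost (weakKernelCost k γ) (midPlan π₁ π₂)
        + ∫ p, F p ∂(midPlan π₁ π₂ : Measure (Y × Y))) :
    π₁ = π₂ := by
  have huc := (hu.continuous hk)
  obtain ⟨C, hC⟩ := exists_norm_le_of_continuous huc
  have hP : IsFiniteMeasure P := by rw [← h₁]; infer_instance
  have hh := fun π : ProbabilityMeasure (Y × Y) =>
    stronglyMeasurable_condEmbedding huc.stronglyMeasurable π
  rw [planCost_midPlan hu hk γ, integral_midPlan (integrable_of_continuous hF _)
    (integrable_of_continuous hF _), h₁, h₂] at hle₁ hle₂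
  set D₁ := ∫ x, ‖condEmbedding u (midPlan π₁ π₂) x - condEmbedding u π₁ x‖ ^ 2 ∂P with hD₁
  set D₂ := ∫ x, ‖condEmbedding u (midPlan π₁ π₂) x - condEmbedding u π₂ x‖ ^ 2 ∂P with hD₂
  have hD₁0 : 0 ≤ D₁ := integral_nonneg fun x => by positivity
  have hD₂0 : 0 ≤ D₂ := integral_nonneg fun x => by positivity
  have hD : D₁ + D₂ ≤ 0 := by
    have : (γ / 4) * (D₁ + D₂) ≤ 0 := by linarith
    exact nonpos_of_mul_nonpos_right this (by positivity)
  have key : ∀ π : ProbabilityMeasure (Y × Y),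
      ∫ x, ‖condEmbedding u (midPlan π₁ π₂) x - condEmbedding u π x‖ ^ 2 ∂P = 0 →
      ∀ᵐ x ∂P, condEmbedding u (midPlan π₁ π₂) x = condEmbedding u π x := by
    intro π h
    have hint : Integrable (fun x => ‖condEmbedding u (midPlan π₁ π₂) x
        - condEmbedding u π x‖ ^ 2) P :=
      integrable_norm_sq_of_bound ((hh _).sub (hh _)) (B := C + C) fun x =>
        (norm_sub_le _ _).trans
          (add_le_add (norm_condEmbedding_le hC _ x) (norm_condEmbedding_le hC _ x))
    rw [integral_eq_zero_iff_of_nonneg (fun x => by positivity) hint] at h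
    filter_upwards [h] with x hx
    simpa [sub_eq_zero] using hx
  apply eq_of_condDist_ae_eq h₁ h₂
  filter_upwards [key π₁ (by linarith), key π₂ (by linarith)] with x hx₁ hx₂
  have hemb : meanEmbedding u ⟨condDist π₁ x, inferInstance⟩
      = meanEmbedding u ⟨condDist π₂ x, inferInstance⟩ := hx₁.symm.trans hx₂
  exact congrArg Subtype.val (hchar hemb)

end Convexity

/-! ### Existence of minimizers, and the first-order condition for an optimal potential -/

section Duality

/-- The functional `π ↦ cost(π) - ∫ f(y) dπ(x, y) + ∫ f dQ` on plans with a free second marginal: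
the transport cost, with `f` as Lagrange multiplier for the constraint on that marginal. -/
noncomputable def lagrangian {X Y : Type*} [MeasurableSpace X] [MeasurableSpace Y]
    [StandardBorelSpace Y] [Nonempty Y] [TopologicalSpace Y] (C : X → Measure Y → ℝ)
    (Q : Measure Y) (f : C(Y, ℝ)) (π : ProbabilityMeasure (X × Y)) : ℝ :=
  planCost C π - (∫ p, f p.2 ∂(π : Measure (X × Y))) + ∫ y, f y ∂Q

lemma lagrangian_eq_planCost_of_snd_eq {X Y : Type*} [MeasurableSpace X] [MeasurableSpace Y]
    [StandardBorelSpace Y] [Nonempty Y] [TopologicalSpace Y] [OpensMeasurableSpace Y]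
    {C : X → Measure Y → ℝ} {Q : Measure Y} (f : C(Y, ℝ)) {π : ProbabilityMeasure (X × Y)}
    (h : (π : Measure (X × Y)).snd = Q) : lagrangian C Q f π = planCost C π := by
  rw [lagrangian, ← h, Measure.snd,
    integral_map measurable_snd.aemeasurable f.continuous.measurable.aestronglyMeasurable]
  ring

lemma isClosed_setOf_map_eq {X Y : Type*} [TopologicalSpace X] [MeasurableSpace X]
    [OpensMeasurableSpace X] [TopologicalSpace Y] [MeasurableSpace Y] [BorelSpace Y]
    [HasOuterApproxClosed Y] {T : X → Y} (hT : Continuous T) (P : Measure Y)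
    [IsProbabilityMeasure P] :
    IsClosed {π : ProbabilityMeasure X | (π : Measure X).map T = P} := by
  let P' : ProbabilityMeasure Y := ⟨P, inferInstance⟩
  have h := (isClosed_singleton (x := P')).preimage (ProbabilityMeasure.continuous_map hT)
  convert h using 1
  ext π
  exact ⟨fun h => Subtype.ext h, fun h => congrArg Subtype.val h⟩

variable {Y : Type*} [MetricSpace Y] [CompactSpace Y] [MeasurableSpace Y] [BorelSpace Y]
  [Nonempty Y] {H : Type*} [NormedAddCommGroup H] [InnerProductSpace ℝ H] [CompleteSpace H]
  {k : Y → Y → ℝ} {u : Y → H}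

lemma lowerSemicontinuous_lagrangian (hu : IsFeatureMap k u)
    (hk : Continuous fun p : Y × Y => k p.1 p.2) {γ : ℝ} (hγ : 0 ≤ γ) (Q : Measure Y)
    (f : C(Y, ℝ)) : LowerSemicontinuous (lagrangian (weakKernelCost k γ) Q f) := by
  have h := (continuous_integral_probabilityMeasure (X := Y × Y)
    (f.continuous.comp continuous_snd)).neg.add (continuous_const (y := ∫ y, f y ∂Q))
  have heq : lagrangian (weakKernelCost k γ) Q f = fun π : ProbabilityMeasure (Y × Y) =>
      planCost (weakKernelCost k γ) π + (-(∫ p, f p.2 ∂(π : Measure (Y × Y))) + ∫ y, f y ∂Q) := by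
    funext π
    rw [lagrangian]
    ring
  rw [heq]
  exact (lowerSemicontinuous_planCost hu hk hγ).add h.lowerSemicontinuous

lemma eq_of_isMin_lagrangian (hu : IsFeatureMap k u)
    (hk : Continuous fun p : Y × Y => k p.1 p.2) (hchar : IsCharacteristic u) {γ : ℝ}
    (hγ : 0 < γ) {P : Measure Y} (Q : Measure Y) (f : C(Y, ℝ))
    {π₁ π₂ : ProbabilityMeasure (Y × Y)}
    (h₁ : (π₁ : Measure (Y × Y)).fst = P) (h₂ : (π₂ : Measure (Y × Y)).fst = P)
    (hmin₁ : ∀ π : ProbabilityMeasure (Y × Y), (π : Measure (Y × Y)).fst = P →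
      lagrangian (weakKernelCost k γ) Q f π₁ ≤ lagrangian (weakKernelCost k γ) Q f π)
    (hle : lagrangian (weakKernelCost k γ) Q f π₂ ≤ lagrangian (weakKernelCost k γ) Q f π₁) :
    π₁ = π₂ := by
  have hmid := hmin₁ _ (map_midPlan_of_map_eq measurable_fst h₁ h₂)
  refine eq_of_le_midPlan hu hk hchar hγ (F := fun p => -f p.2)
    (f.continuous.comp continuous_snd).neg h₁ h₂ ?_ ?_
  · simp only [integral_neg]
    simp only [lagrangian] at hmid
    linarith
  · simp only [integral_neg]
    simp only [lagrangian] at hmid hle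
    linarith

lemma lagrangian_add_smul (C : Y → Measure Y → ℝ) (Q : Measure Y) [IsFiniteMeasure Q]
    (f g : C(Y, ℝ)) (t : ℝ) (π : ProbabilityMeasure (Y × Y)) :
    lagrangian C Q (f + t • g) π
      = lagrangian C Q f π + t * ((∫ y, g y ∂Q) - ∫ p, g p.2 ∂(π : Measure (Y × Y))) := by
  have hi := fun h : C(Y, ℝ) => integrable_of_continuous h.continuous Q
  have hi' := fun h : C(Y, ℝ) =>
    integrable_of_continuous (h.continuous.comp continuous_snd) (π : Measure (Y × Y))
  simp only [Function.comp_def] at hi'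
  simp only [lagrangian, ContinuousMap.add_apply, ContinuousMap.smul_apply, smul_eq_mul]
  rw [integral_add (hi f) ((hi g).const_mul t), integral_add (hi' f) ((hi' g).const_mul t),
    integral_const_mul, integral_const_mul]
  ring

/-- An envelope argument: if perturbing the potential `f` in the direction `g` cannot increase the
minimum of the Lagrangian over the plans with first marginal `P`, then the directional derivative
of that minimum, which is computed at the unique minimizer `π₀`, is nonpositive. -/
lemma integral_le_integral_of_isMax (hu : IsFeatureMap k u)
    (hk : Continuous fun p : Y × Y => k p.1 p.2) (hchar : IsCharacteristic u) {γ : ℝ}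
    (hγ : 0 < γ) {P Q : Measure Y} [IsProbabilityMeasure P] [IsProbabilityMeasure Q] {f : C(Y, ℝ)}
    {π₀ : ProbabilityMeasure (Y × Y)} (h₀ : (π₀ : Measure (Y × Y)).fst = P)
    (hmin : ∀ π : ProbabilityMeasure (Y × Y), (π : Measure (Y × Y)).fst = P →
      lagrangian (weakKernelCost k γ) Q f π₀ ≤ lagrangian (weakKernelCost k γ) Q f π)
    (hmax : ∀ g : C(Y, ℝ), ∃ π : ProbabilityMeasure (Y × Y), (π : Measure (Y × Y)).fst = P ∧
      lagrangian (weakKernelCost k γ) Q g π ≤ lagrangian (weakKernelCost k γ) Q f π₀)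
    (g : C(Y, ℝ)) : ∫ y, g y ∂Q ≤ ∫ p, g p.2 ∂(π₀ : Measure (Y × Y)) := by
  by_contra! hlt
  set G : ProbabilityMeasure (Y × Y) → ℝ :=
    fun π => (∫ y, g y ∂Q) - ∫ p, g p.2 ∂(π : Measure (Y × Y)) with hG
  have hGc : Continuous G := continuous_const.sub
    (continuous_integral_probabilityMeasure (g.continuous.comp continuous_snd))
  have hc : 0 < G π₀ := sub_pos.2 hlt
  obtain ⟨B, hB⟩ := exists_norm_le_of_continuous g.continuous
  have hGB : ∀ π, -(2 * B) ≤ G π := by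
    intro π
    have h1 := norm_integral_le_of_norm_le_const (μ := Q) (.of_forall hB)
    have h2 := norm_integral_le_of_norm_le_const (μ := (π : Measure (Y × Y)))
      (f := fun p => g p.2) (.of_forall fun p => hB p.2)
    simp only [probReal_univ, mul_one, Real.norm_eq_abs] at h1 h2
    have := (abs_le.1 h1).1
    have := (abs_le.1 h2).2
    simp only [hG]
    linarith
  have hB0 : 0 ≤ B := (norm_nonneg _).trans (hB (Classical.arbitrary Y))
  -- Away from `π₀`, namely where `G ≤ G π₀ / 2`, the Lagrangian exceeds its minimum by some `δ`.
  obtain ⟨δ, hδ, hδA⟩ : ∃ δ > 0, ∀ π : ProbabilityMeasure (Y × Y),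
      (π : Measure (Y × Y)).fst = P → G π ≤ G π₀ / 2 →
      lagrangian (weakKernelCost k γ) Q f π₀ + δ ≤ lagrangian (weakKernelCost k γ) Q f π := by
    set A : Set (ProbabilityMeasure (Y × Y)) :=
      {π | (π : Measure (Y × Y)).map Prod.fst = P} ∩ {π | G π ≤ G π₀ / 2} with hA
    have hAc : IsCompact A :=
      ((isClosed_setOf_map_eq continuous_fst P).inter
        (isClosed_le hGc continuous_const)).isCompact
    rcases A.eq_empty_or_nonempty with hAe | hAn
    · exact ⟨1, one_pos, fun π h h' => absurd (show π ∈ A from ⟨h, h'⟩) (by simp [hAe])⟩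
    · obtain ⟨π₁, hπ₁, hπ₁min⟩ := LowerSemicontinuousOn.exists_isMinOn hAn hAc
        ((lowerSemicontinuous_lagrangian hu hk hγ.le Q f).lowerSemicontinuousOn A)
      have hlt : lagrangian (weakKernelCost k γ) Q f π₀
          < lagrangian (weakKernelCost k γ) Q f π₁ := by
        by_contra! hle
        have heq := eq_of_isMin_lagrangian hu hk hchar hγ Q f h₀ hπ₁.1 hmin hle
        have : G π₁ ≤ G π₀ / 2 := hπ₁.2
        rw [← heq] at this
        linarith
      refine ⟨_, sub_pos.2 hlt, fun π h h' => ?_⟩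
      have : _ ≤ lagrangian (weakKernelCost k γ) Q f π := hπ₁min (show π ∈ A from ⟨h, h'⟩)
      linarith
  -- As `|G| ≤ 2B`, a step this short loses less than `δ` where `G ≤ G π₀ / 2`; elsewhere `G > 0`.
  set t := δ / (2 * B + 1) with ht
  have htpos : 0 < t := by positivity
  have htδ : t * (2 * B) < δ := by
    rw [ht, div_mul_eq_mul_div, div_lt_iff₀ (by positivity)]
    nlinarith
  obtain ⟨π, hπ, hle⟩ := hmax (f + t • g)
  rw [lagrangian_add_smul] at hle
  change _ + t * G π ≤ _ at hle
  rcases le_or_gt (G π) (G π₀ / 2) with h | h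
  · have h1 := hδA π hπ h
    have h2 := mul_le_mul_of_nonneg_left (hGB π) htpos.le
    linarith
  · have h1 := hmin π hπ
    have h2 : 0 < t * G π := mul_pos htpos (by linarith)
    linarith

lemma snd_eq_of_isMax (hu : IsFeatureMap k u)
    (hk : Continuous fun p : Y × Y => k p.1 p.2) (hchar : IsCharacteristic u) {γ : ℝ}
    (hγ : 0 < γ) {P Q : Measure Y} [IsProbabilityMeasure P] [IsProbabilityMeasure Q] {f : C(Y, ℝ)}
    {π₀ : ProbabilityMeasure (Y × Y)} (h₀ : (π₀ : Measure (Y × Y)).fst = P)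
    (hmin : ∀ π : ProbabilityMeasure (Y × Y), (π : Measure (Y × Y)).fst = P →
      lagrangian (weakKernelCost k γ) Q f π₀ ≤ lagrangian (weakKernelCost k γ) Q f π)
    (hmax : ∀ g : C(Y, ℝ), ∃ π : ProbabilityMeasure (Y × Y), (π : Measure (Y × Y)).fst = P ∧
      lagrangian (weakKernelCost k γ) Q g π ≤ lagrangian (weakKernelCost k γ) Q f π₀) :
    (π₀ : Measure (Y × Y)).snd = Q := by
  have hle := integral_le_integral_of_isMax hu hk hchar hγ h₀ hmin hmax
  refine ext_of_forall_integral_eq_of_IsFiniteMeasure fun g => ?_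
  rw [Measure.snd, integral_map measurable_snd.aemeasurable
    g.continuous.measurable.aestronglyMeasurable]
  refine le_antisymm ?_ (hle g.toContinuousMap)
  have h := hle (-g.toContinuousMap)
  simp only [ContinuousMap.neg_apply, integral_neg, neg_le_neg_iff] at h
  exact h

lemma exists_isMin_lagrangian (hu : IsFeatureMap k u)
    (hk : Continuous fun p : Y × Y => k p.1 p.2) {γ : ℝ} (hγ : 0 ≤ γ) (P Q : Measure Y)
    [IsProbabilityMeasure P] [IsProbabilityMeasure Q] (f : C(Y, ℝ)) :
    ∃ π₀ : ProbabilityMeasure (Y × Y), (π₀ : Measure (Y × Y)).fst = P ∧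
      ∀ π : ProbabilityMeasure (Y × Y), (π : Measure (Y × Y)).fst = P →
        lagrangian (weakKernelCost k γ) Q f π₀ ≤ lagrangian (weakKernelCost k γ) Q f π := by
  obtain ⟨π₀, h₀, hmin⟩ := LowerSemicontinuousOn.exists_isMinOn
    (s := {π : ProbabilityMeasure (Y × Y) | (π : Measure (Y × Y)).map Prod.fst = P})
    ⟨⟨P.prod Q, inferInstance⟩, Measure.fst_prod⟩
    (isClosed_setOf_map_eq continuous_fst P).isCompact
    ((lowerSemicontinuous_lagrangian hu hk hγ Q f).lowerSemicontinuousOn _)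
  exact ⟨π₀, h₀, fun π hπ => hmin hπ⟩

lemma exists_isOTPlan (hu : IsFeatureMap k u)
    (hk : Continuous fun p : Y × Y => k p.1 p.2) {γ : ℝ} (hγ : 0 ≤ γ) (P Q : Measure Y)
    [IsProbabilityMeasure P] [IsProbabilityMeasure Q] :
    ∃ π, IsOTPlan (weakKernelCost k γ) P Q π := by
  obtain ⟨π₀, h₀, hmin⟩ := LowerSemicontinuousOn.exists_isMinOn
    (s := {π : ProbabilityMeasure (Y × Y) | (π : Measure (Y × Y)).map Prod.fst = P}
      ∩ {π | (π : Measure (Y × Y)).map Prod.snd = Q})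
    ⟨⟨P.prod Q, inferInstance⟩, Measure.fst_prod, Measure.snd_prod⟩
    ((isClosed_setOf_map_eq continuous_fst P).inter
      (isClosed_setOf_map_eq continuous_snd Q)).isCompact
    ((lowerSemicontinuous_planCost hu hk hγ).lowerSemicontinuousOn _)
  exact ⟨π₀, h₀, fun π hπ => hmin hπ⟩

lemma IsOTPlan.unique (hu : IsFeatureMap k u)
    (hk : Continuous fun p : Y × Y => k p.1 p.2) (hchar : IsCharacteristic u) {γ : ℝ}
    (hγ : 0 < γ) {P Q : Measure Y} {π₁ π₂ : ProbabilityMeasure (Y × Y)}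
    (h₁ : IsOTPlan (weakKernelCost k γ) P Q π₁) (h₂ : IsOTPlan (weakKernelCost k γ) P Q π₂) :
    π₁ = π₂ := by
  have hmid : IsTransportPlan P Q (midPlan π₁ π₂) :=
    ⟨map_midPlan_of_map_eq measurable_fst h₁.1.1 h₂.1.1,
      map_midPlan_of_map_eq measurable_snd h₁.1.2 h₂.1.2⟩
  refine eq_of_le_midPlan hu hk hchar hγ (F := fun _ => 0) continuous_const h₁.1.1 h₂.1.1 ?_ ?_
  · simpa using h₁.2 _ hmid
  · simpa using h₂.2 _ hmid

end Duality

/-! ### Representing kernels by maps of an atomless noise variable -/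

section Noise

lemma continuous_cdf_of_singleton_eq_zero (ν : Measure ℝ) [IsProbabilityMeasure ν]
    (hν : ∀ a, ν {a} = 0) : Continuous (cdf ν) := by
  rw [continuous_iff_continuousAt]
  intro a
  rw [(monotone_cdf ν).continuousAt_iff_leftLim_eq_rightLim, (cdf ν).rightLim_eq]
  have h := (cdf ν).measure_singleton a
  rw [measure_cdf, hν a, eq_comm, ENNReal.ofReal_eq_zero] at h
  exact le_antisymm ((monotone_cdf ν).leftLim_le le_rfl) (by linarith)

/-- The probability integral transform: the distribution function of an atomless law on `ℝ` is
uniformly distributed under that law. -/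
lemma real_setOf_cdf_le (ν : Measure ℝ) [IsProbabilityMeasure ν] (hν : ∀ a, ν {a} = 0) (t : I) :
    ν.real {a | cdf ν a ≤ t} = t := by
  have hex : ∀ s ∈ Set.Ioo (0 : ℝ) 1, ∃ c, cdf ν c = s := fun s hs =>
    mem_range_of_exists_le_of_exists_ge (continuous_cdf_of_singleton_eq_zero ν hν)
      (((tendsto_cdf_atBot ν).eventually (ge_mem_nhds hs.1)).exists)
      (((tendsto_cdf_atTop ν).eventually (le_mem_nhds hs.2)).exists)
  apply le_antisymm
  · by_contra! h
    obtain ⟨s, hts, hs⟩ := exists_between h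
    obtain ⟨c, hc⟩ := hex s ⟨t.2.1.trans_lt hts, hs.trans_le measureReal_le_one⟩
    have hsub : {a | cdf ν a ≤ t} ⊆ Set.Iic c := by
      intro a ha
      by_contra! hca
      have h1 := monotone_cdf ν (le_of_lt (not_le.1 hca))
      have h2 : cdf ν a ≤ t := ha
      linarith
    have h3 : ν.real {a | cdf ν a ≤ t} ≤ ν.real (Set.Iic c) := measureReal_mono hsub
    rw [← cdf_eq_real, hc] at h3
    linarith
  · rcases t.2.1.eq_or_lt with h0 | h0
    · rw [← h0]
      exact measureReal_nonneg
    rcases t.2.2.eq_or_lt with h1 | h1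
    · have : {a | cdf ν a ≤ t} = Set.univ := by
        ext a
        simp [h1, cdf_le_one ν a]
      rw [this, h1, probReal_univ]
    · obtain ⟨c, hc⟩ := hex t ⟨h0, h1⟩
      have hsub : Set.Iic c ⊆ {a | cdf ν a ≤ t} := fun a ha => (monotone_cdf ν ha).trans hc.le
      calc (t : ℝ) = ν.real (Set.Iic c) := by rw [← cdf_eq_real, hc]
        _ ≤ _ := measureReal_mono hsub

variable {Z : Type*} [MeasurableSpace Z] [StandardBorelSpace Z]

lemma exists_measurable_map_eq_volume_unitInterval (S : Measure Z) [IsProbabilityMeasure S]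
    (hS : ∀ z, S {z} = 0) : ∃ φ : Z → I, Measurable φ ∧ S.map φ = volume := by
  have he := measurableEmbedding_embeddingReal Z
  set ν := S.map (embeddingReal Z) with hνdef
  have : IsProbabilityMeasure ν := Measure.isProbabilityMeasure_map he.measurable.aemeasurable
  have hν : ∀ a, ν {a} = 0 := by
    intro a
    rw [hνdef, Measure.map_apply he.measurable (measurableSet_singleton a)]
    rcases (Set.subsingleton_singleton.preimage he.injective).eq_empty_or_singleton
      with h | ⟨z, h⟩
    · rw [h, measure_empty]
    · rw [h, hS z]
  have hF : Measurable (cdf ν) := (monotone_cdf ν).measurable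
  have hφ : Measurable fun z => (⟨cdf ν (embeddingReal Z z), cdf_nonneg ν _, cdf_le_one ν _⟩ : I) :=
    (hF.comp he.measurable).subtype_mk
  refine ⟨_, hφ, Measure.ext_of_Iic _ _ fun t => ?_⟩
  have hset : ν {a | cdf ν a ≤ t} = S (embeddingReal Z ⁻¹' {a | cdf ν a ≤ t}) :=
    Measure.map_apply he.measurable (hF measurableSet_Iic)
  rw [Measure.map_apply hφ measurableSet_Iic, unitInterval.volume_Iic,
    ← real_setOf_cdf_le ν hν t, ofReal_measureReal, hset]
  rfl

/-- Noise outsourcing: every Markov kernel is the law of `T(x, z)` for a measurable `T` and an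
atomless noise `z`. -/
lemma exists_measurable_pushAt_eq {X Y : Type*} [MeasurableSpace X] [MeasurableSpace Y]
    [StandardBorelSpace Y] [Nonempty Y] (S : Measure Z) [IsProbabilityMeasure S]
    (hS : ∀ z, S {z} = 0) (κ : Kernel X Y) [IsMarkovKernel κ] :
    ∃ T : X × Z → Y, Measurable T ∧ ∀ x, pushAt S T x = κ x := by
  obtain ⟨φ, hφ, hφS⟩ := exists_measurable_map_eq_volume_unitInterval S hS
  obtain ⟨h, hh, hhκ⟩ := Kernel.exists_measurable_map_eq_unitInterval κ
  refine ⟨fun p => h p.1 (φ p.2),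
    hh.comp (measurable_fst.prodMk (hφ.comp measurable_snd)), fun x => ?_⟩
  rw [← hhκ x, ← hφS, Measure.map_map (hh.of_uncurry_left) hφ]
  rfl

end Noise

/-! ### The plan induced by a stochastic map -/

section MapPlan

variable {X Y Z : Type*} [MeasurableSpace X] [MeasurableSpace Y] [MeasurableSpace Z]

/-- The Markov kernel `x ↦ T_x ♯ S`. -/
noncomputable def pushKernel (S : Measure Z) [IsProbabilityMeasure S] {T : X × Z → Y}
    (hT : Measurable T) : Kernel X Y :=
  ⟨pushAt S T, by
    refine Measure.measurable_of_measurable_coe _ fun s hs => ?_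
    have h : ∀ x, pushAt S T x s = S (Prod.mk x ⁻¹' (T ⁻¹' s)) := fun x =>
      Measure.map_apply (hT.comp measurable_prodMk_left) hs
    simp only [h]
    exact measurable_measure_prodMk_left (hT hs)⟩

instance (S : Measure Z) [IsProbabilityMeasure S] {T : X × Z → Y} (hT : Measurable T) :
    IsMarkovKernel (pushKernel S hT) :=
  ⟨fun _ => Measure.isProbabilityMeasure_map (hT.comp measurable_prodMk_left).aemeasurable⟩

/-- The plan with first marginal `P` and conditional distributions `T_x ♯ S`. -/
noncomputable def mapPlan (P : Measure X) [IsProbabilityMeasure P] (S : Measure Z)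
    [IsProbabilityMeasure S] {T : X × Z → Y} (hT : Measurable T) : ProbabilityMeasure (X × Y) :=
  ⟨P ⊗ₘ pushKernel S hT, inferInstance⟩

variable (P : Measure X) [IsProbabilityMeasure P] (S : Measure Z) [IsProbabilityMeasure S]

lemma fst_mapPlan {T : X × Z → Y} (hT : Measurable T) :
    (mapPlan P S hT : Measure (X × Y)).fst = P :=
  Measure.fst_compProd P (pushKernel S hT)

variable [StandardBorelSpace Y] [Nonempty Y]

lemma represents_mapPlan {T : X × Z → Y} (hT : Measurable T) :
    Represents P S T (mapPlan P S hT) := by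
  have h := eq_condKernel_of_measure_eq_compProd (ρ := (mapPlan P S hT : Measure (X × Y)))
    (pushKernel S hT) (by rw [fst_mapPlan]; rfl)
  rw [fst_mapPlan] at h
  exact h

variable {P} in
lemma represents_iff_mapPlan_eq {T : X × Z → Y} (hT : Measurable T)
    {π : ProbabilityMeasure (X × Y)} (hπ : (π : Measure (X × Y)).fst = P) :
    Represents P S T π ↔ mapPlan P S hT = π := by
  refine ⟨fun h => eq_of_condDist_ae_eq (fst_mapPlan P S hT) hπ ?_, fun h => ?_⟩
  · filter_upwards [h, represents_mapPlan P S hT] with x h₁ h₂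
    exact h₂.symm.trans h₁
  · rw [← h]
    exact represents_mapPlan P S hT

variable {P} in
lemma exists_mapPlan_eq [StandardBorelSpace Z] (hS : ∀ z, S {z} = 0)
    {π : ProbabilityMeasure (X × Y)} (hπ : (π : Measure (X × Y)).fst = P) :
    ∃ (T : X × Z → Y) (hT : Measurable T), mapPlan P S hT = π := by
  obtain ⟨T, hT, h⟩ := exists_measurable_pushAt_eq S hS (π : Measure (X × Y)).condKernel
  exact ⟨T, hT, (represents_iff_mapPlan_eq S hT hπ).1 (.of_forall h)⟩

end MapPlan

/-! ### The saddle functional -/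

section Saddle

variable {Y : Type*} [MetricSpace Y] [CompactSpace Y] [MeasurableSpace Y] [BorelSpace Y]
  [Nonempty Y] {H : Type*} [NormedAddCommGroup H] [InnerProductSpace ℝ H] [CompleteSpace H]
  {k : Y → Y → ℝ} {u : Y → H} {Z : Type*} [MeasurableSpace Z]

lemma saddle_eq_lagrangian_mapPlan (hu : IsFeatureMap k u)
    (hk : Continuous fun p : Y × Y => k p.1 p.2) (γ : ℝ) (P Q : Measure Y)
    [IsProbabilityMeasure P] (S : Measure Z) [IsProbabilityMeasure S] (f : C(Y, ℝ))
    {T : Y × Z → Y} (hT : Measurable T) :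
    saddle (weakKernelCost k γ) P Q S f T
      = lagrangian (weakKernelCost k γ) Q f (mapPlan P S hT) := by
  set π := mapPlan P S hT with hπ
  have hfst : (π : Measure (Y × Y)).fst = P := fst_mapPlan P S hT
  have hf : Integrable (fun p : Y × Y => f p.2) (π : Measure (Y × Y)) :=
    integrable_of_continuous (f.continuous.comp continuous_snd) _
  have hcost := integrable_weakKernelCost_condDist hu hk γ π
  have hfi : Integrable (fun x => ∫ y, f y ∂(condDist π x)) (π : Measure (Y × Y)).fst :=
    hf.integral_condKernel
  rw [saddle, lagrangian, planCost, ← integral_condDist π hf, ← integral_sub hcost hfi, hfst]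
  congr 1
  refine integral_congr_ae ?_
  filter_upwards [represents_mapPlan P S hT] with x hx
  have hTx : AEMeasurable (fun z => T (x, z)) S := (hT.comp measurable_prodMk_left).aemeasurable
  rw [← hx, pushAt, integral_map hTx f.continuous.measurable.aestronglyMeasurable]

variable [StandardBorelSpace Z]

lemma dualValue_eq_lagrangian (hu : IsFeatureMap k u)
    (hk : Continuous fun p : Y × Y => k p.1 p.2) (γ : ℝ) {P Q : Measure Y}
    [IsProbabilityMeasure P] (S : Measure Z) [IsProbabilityMeasure S] (hS : ∀ z, S {z} = 0)
    {f : C(Y, ℝ)} {π₀ : ProbabilityMeasure (Y × Y)} (h₀ : (π₀ : Measure (Y × Y)).fst = P)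
    (hmin : ∀ π : ProbabilityMeasure (Y × Y), (π : Measure (Y × Y)).fst = P →
      lagrangian (weakKernelCost k γ) Q f π₀ ≤ lagrangian (weakKernelCost k γ) Q f π) :
    dualValue (weakKernelCost k γ) P Q S f = lagrangian (weakKernelCost k γ) Q f π₀ := by
  obtain ⟨T₀, hT₀, hT₀π⟩ := exists_mapPlan_eq S hS h₀
  have hle : ∀ T : {T : Y × Z → Y // Measurable T}, lagrangian (weakKernelCost k γ) Q f π₀
      ≤ saddle (weakKernelCost k γ) P Q S f T.1 := by
    rintro ⟨T, hT⟩
    rw [saddle_eq_lagrangian_mapPlan hu hk γ P Q S f hT]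
    exact hmin _ (fst_mapPlan P S hT)
  have : Nonempty {T : Y × Z → Y // Measurable T} := ⟨⟨T₀, hT₀⟩⟩
  refine le_antisymm ?_ (le_ciInf hle)
  refine (ciInf_le ⟨_, Set.forall_mem_range.2 hle⟩ ⟨T₀, hT₀⟩).trans (le_of_eq ?_)
  rw [saddle_eq_lagrangian_mapPlan hu hk γ P Q S f hT₀, hT₀π]

/-- The unique minimizer of the Lagrangian of an optimal potential is an optimal transport plan. -/
lemma isOTPlan_of_isOptimalPotential (hu : IsFeatureMap k u)
    (hk : Continuous fun p : Y × Y => k p.1 p.2) (hchar : IsCharacteristic u) {γ : ℝ}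
    (hγ : 0 < γ) {P Q : Measure Y} [IsProbabilityMeasure P] [IsProbabilityMeasure Q]
    {S : Measure Z} [IsProbabilityMeasure S] (hS : ∀ z, S {z} = 0) {f : C(Y, ℝ)}
    (hf : IsOptimalPotential (weakKernelCost k γ) P Q S f)
    {π₀ : ProbabilityMeasure (Y × Y)} (h₀ : (π₀ : Measure (Y × Y)).fst = P)
    (hmin : ∀ π : ProbabilityMeasure (Y × Y), (π : Measure (Y × Y)).fst = P →
      lagrangian (weakKernelCost k γ) Q f π₀ ≤ lagrangian (weakKernelCost k γ) Q f π) :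
    IsOTPlan (weakKernelCost k γ) P Q π₀ := by
  have hsnd : (π₀ : Measure (Y × Y)).snd = Q := by
    refine snd_eq_of_isMax hu hk hchar hγ h₀ hmin fun g => ?_
    obtain ⟨π, hπ, hπmin⟩ := exists_isMin_lagrangian hu hk hγ.le P Q g
    refine ⟨π, hπ, ?_⟩
    rw [← dualValue_eq_lagrangian hu hk γ S hS hπ hπmin,
      ← dualValue_eq_lagrangian hu hk γ S hS h₀ hmin]
    exact hf g
  refine ⟨⟨h₀, hsnd⟩, fun π hπ => ?_⟩
  have h := hmin π hπ.1
  rwa [lagrangian_eq_planCost_of_snd_eq f hsnd, lagrangian_eq_planCost_of_snd_eq f hπ.2] at h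

lemma isArginf_iff_represents (hu : IsFeatureMap k u)
    (hk : Continuous fun p : Y × Y => k p.1 p.2) (hchar : IsCharacteristic u) {γ : ℝ}
    (hγ : 0 < γ) {P Q : Measure Y} [IsProbabilityMeasure P]
    {S : Measure Z} [IsProbabilityMeasure S] (hS : ∀ z, S {z} = 0) {f : C(Y, ℝ)}
    {π₀ : ProbabilityMeasure (Y × Y)} (h₀ : (π₀ : Measure (Y × Y)).fst = P)
    (hmin : ∀ π : ProbabilityMeasure (Y × Y), (π : Measure (Y × Y)).fst = P →
      lagrangian (weakKernelCost k γ) Q f π₀ ≤ lagrangian (weakKernelCost k γ) Q f π)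
    {T : Y × Z → Y} (hT : Measurable T) :
    IsArginf (weakKernelCost k γ) P Q S f T ↔ Represents P S T π₀ := by
  rw [represents_iff_mapPlan_eq S hT h₀]
  constructor
  · rintro ⟨-, harg⟩
    obtain ⟨T₀, hT₀, hT₀π⟩ := exists_mapPlan_eq S hS h₀
    have h := harg T₀ hT₀
    rw [saddle_eq_lagrangian_mapPlan hu hk γ P Q S f hT,
      saddle_eq_lagrangian_mapPlan hu hk γ P Q S f hT₀, hT₀π] at h
    exact (eq_of_isMin_lagrangian hu hk hchar hγ Q f h₀ (fst_mapPlan P S hT) hmin h).symm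
  · intro h
    refine ⟨hT, fun T' hT' => ?_⟩
    rw [saddle_eq_lagrangian_mapPlan hu hk γ P Q S f hT,
      saddle_eq_lagrangian_mapPlan hu hk γ P Q S f hT', h]
    exact hmin _ (fst_mapPlan P S hT')

end Saddle

end KernelNOT

theorem theorem2 {D : ℕ} (K : Set (EuclideanSpace ℝ (Fin D))) [CompactSpace K] [Nonempty K]
    {Z : Type*} [TopologicalSpace Z] [PolishSpace Z] [MeasurableSpace Z] [BorelSpace Z]
    {H : Type*} [NormedAddCommGroup H] [InnerProductSpace ℝ H] [CompleteSpace H]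
    (k : K → K → ℝ) (u : K → H) (hu : KernelNOT.IsFeatureMap k u)
    (hk : Continuous fun p : K × K => k p.1 p.2) (hchar : KernelNOT.IsCharacteristic u)
    (γ : ℝ) (hγ : γ ∈ Set.Ioc (0 : ℝ) 1)
    (P Q : Measure K) [IsProbabilityMeasure P] [IsProbabilityMeasure Q]
    (S : Measure Z) [IsProbabilityMeasure S] (hS : ∀ z, S {z} = 0) :
    ∃ π : ProbabilityMeasure (K × K),
      (∀ π', KernelNOT.IsOTPlan (KernelNOT.weakKernelCost k γ) P Q π' ↔ π' = π) ∧
      ∀ f : C(K, ℝ), KernelNOT.IsOptimalPotential (KernelNOT.weakKernelCost k γ) P Q S f →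
        ∀ T : K × Z → K, Measurable T →
          (KernelNOT.IsArginf (KernelNOT.weakKernelCost k γ) P Q S f T ↔
            KernelNOT.Represents P S T π) ∧
          (KernelNOT.IsArginf (KernelNOT.weakKernelCost k γ) P Q S f T →
            KernelNOT.IsStochasticOTMap (KernelNOT.weakKernelCost k γ) P Q S T) := by
  obtain ⟨π, hπ⟩ := KernelNOT.exists_isOTPlan hu hk hγ.1.le P Q
  refine ⟨π, fun π' => ⟨fun h => h.unique hu hk hchar hγ.1 hπ, fun h => h ▸ hπ⟩, ?_⟩
  intro f hf T hT
  obtain ⟨π₀, h₀, hmin⟩ := KernelNOT.exists_isMin_lagrangian hu hk hγ.1.le P Q f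
  have hπ₀ : π₀ = π := (KernelNOT.isOTPlan_of_isOptimalPotential hu hk hchar hγ.1 hS hf
    h₀ hmin).unique hu hk hchar hγ.1 hπ
  have hiff := KernelNOT.isArginf_iff_represents hu hk hchar hγ.1 hS h₀ hmin hT
  rw [hπ₀] at hiff
  exact ⟨hiff, fun h => ⟨hT, π, hπ, hiff.1 h⟩⟩
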